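/- Let $0<\gamma<1$. Let the five tetrahedra of a 4-simplex be labelled by $a\in\{1,\dots,5\}$ and let boundary data of the Euclidean EPRL vertex be given: spins $k_{ab}=k_{ba}>0$ for $a\ne b$ such that $2j^\pm_{ab}:=(1\pm\gamma)k_{ab}$ are integers, and unit spinors $\xi_{ab}\in\mathbb C^2$ for $a\neq b$. Put $n_{ab}=\langle\xi_{ab}|\vec\sigma|\xi_{ab}\rangle\in\mathbb R^3$. With $\mathrm{Spin}(4)=SU(2)\times SU(2)$, $g_a=(g_a^+,g_a^-)$ and the gauge fixing $g_5=1$, the integrand of the vertex amplitude is the function on $\prod_{a=1}^4\mathrm{Spin}(4)$ $$\prod_{1\le a<b\le 5}\ \prod_{\pm}\ \langle J\xi_{ab}\,|\,(g_a^\pm)^{-1}g_b^\pm\,\xi_{ba}\rangle^{2j^\pm_{ab}},\qquad J(z_0,z_1)=(-\bar z_1,\bar z_0).$$ An action near a point $g$ is a complex function $S$, twice continuously differentiable at $g$, such that $e^{iS}$ is the integrand in a neighbourhood of $g$. A point $g$ corresponds to a nondegenerate 4-simplex if there are affinely independent points $p_1,\dots,p_5\in\mathbb R^4$ and a global sign $\mu\in\{1,-1\}$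 such that for all $a\ne b$ the geometric bivector $$B_{ab}=\tfrac12\,\mathrm{sgn}(a,b,c,d,e)\,(p_d-p_c)\wedge(p_e-p_c),\qquad \{c,d,e\}=\{1,\dots,5\}\setminus\{a,b\},$$ (the oriented area bivector of the triangle shared by the tetrahedra opposite to $p_a$ and $p_b$) has self-dual and anti-self-dual parts $\mu k_{ab}\,g_a^+n_{ab}$ and $\mu k_{ab}\,g_a^-n_{ab}$. Here $SU(2)$ acts on $\mathbb R^3$ by rotations, and the self-dual and anti-self-dual parts of a bivector $B$ are the vectors in $\mathbb R^3$ with components $\tfrac12\sum_{j,k}\epsilon_{ijk}B_{jk}\pm B_{0i}$. **Theorem.** Let $g$ be a stationary point of an action $S$ near $g$ (that is, $dS=0$ at $g$) and suppose that $g$ corresponds to a nondegenerate 4-simplex. Then the Hessian $\partial^2S$ at $g$, a complex symmetric bilinear form on the 24-dimensional tangent space $T_g\prod_{a=1}^4\mathrm{Spin}(4)\cong\{v:\{1,\dots,5\}\to\mathbb R^3\oplus\mathbb R^3,\ v(5)=0\}$, is nondegenerate: no nonzero vector of the complexified tangent space annihilates it. -/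

import Mathlib

open scoped Matrix Topology

namespace EPRL

/-! ## `SU(2)`, spinors and `Spin(4)` -/

/-- The group `SU(2)`. -/
abbrev SU2 : Type := Matrix.specialUnitaryGroup (Fin 2) ℂ

/-- `Spin(4) = SU(2) × SU(2)`; the first factor is the self-dual part `g⁺`, the second one the
anti-self-dual part `g⁻`. -/
abbrev Spin4 : Type := SU2 × SU2

/-- The Pauli matrices. -/
def pauli : Fin 3 → Matrix (Fin 2) (Fin 2) ℂ :=
  ![!![0, 1; 1, 0], !![0, -Complex.I; Complex.I, 0], !![1, 0; 0, -1]]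

/-- The isomorphism `ℝ³ ≅ su(2)`, `v ↦ (i/2) ∑ v_i σ_i`. -/
noncomputable def su2Mat (v : Fin 3 → ℝ) : Matrix (Fin 2) (Fin 2) ℂ :=
  (Complex.I / 2) • ∑ i, (v i : ℂ) • pauli i

theorem su2Mat_conjTranspose (v : Fin 3 → ℝ) : (su2Mat v)ᴴ = -su2Mat v := by
  ext i j
  fin_cases i <;> fin_cases j <;>
    simp [su2Mat, pauli, Fin.sum_univ_three, Matrix.conjTranspose_apply] <;> ring

theorem su2Mat_transpose (v : Fin 3 → ℝ) :
    !![0, 1; -1, 0] * (su2Mat v)ᵀ * (!![0, 1; -1, 0] : Matrix (Fin 2) (Fin 2) ℂ)⁻¹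
      = -su2Mat v := by
  rw [Matrix.inv_def]
  ext i j
  fin_cases i <;> fin_cases j <;>
    simp [su2Mat, pauli, Fin.sum_univ_three, Matrix.mul_apply, Matrix.adjugate_fin_two,
      Matrix.det_fin_two, Matrix.vecMul, dotProduct, Matrix.transpose_apply]

theorem exp_su2Mat_mem (v : Fin 3 → ℝ) :
    NormedSpace.exp (su2Mat v) ∈ Matrix.specialUnitaryGroup (Fin 2) ℂ := by
  have hinv : NormedSpace.exp (su2Mat v) * NormedSpace.exp (-su2Mat v) = 1 := by
    rw [Matrix.exp_neg]
    exact Matrix.mul_nonsing_inv _ ((Matrix.isUnit_iff_isUnit_det _).1 (Matrix.isUnit_exp _))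
  rw [Matrix.mem_specialUnitaryGroup_iff]
  constructor
  · rw [Matrix.mem_unitaryGroup_iff, Matrix.star_eq_conjTranspose, ← Matrix.exp_conjTranspose,
      su2Mat_conjTranspose, hinv]
  · have hu : IsUnit (!![0, 1; -1, 0] : Matrix (Fin 2) (Fin 2) ℂ) := by
      rw [Matrix.isUnit_iff_isUnit_det]
      simp [Matrix.det_fin_two]
    rw [← su2Mat_transpose, Matrix.exp_conj _ _ hu, Matrix.exp_transpose] at hinv
    have h := congrFun (congrFun hinv 0) 0
    rw [Matrix.inv_def] at h
    simp [Matrix.mul_apply, Matrix.adjugate_fin_two, Matrix.det_fin_two, Matrix.vecMul, dotProduct,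
      Matrix.transpose_apply] at h
    rw [Matrix.det_fin_two]
    linear_combination h

/-- The exponential map `ℝ³ ≅ su(2) → SU(2)`. -/
noncomputable def expSU2 (v : Fin 3 → ℝ) : SU2 := ⟨NormedSpace.exp (su2Mat v), exp_su2Mat_mem v⟩

/-- The antilinear structure map `J` on spinors. -/
noncomputable def spinorJ (ξ : Fin 2 → ℂ) : Fin 2 → ℂ := ![-star (ξ 1), star (ξ 0)]

/-- The vector `⟨ξ|σ|ξ⟩ ∈ ℝ³`; it is a unit vector if `ξ` is a unit spinor. -/
noncomputable def spinorVec (ξ : Fin 2 → ℂ) : Fin 3 → ℝ :=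
  fun i => (star ξ ⬝ᵥ (pauli i *ᵥ ξ)).re

/-! ## Boundary data, integrand, action, Hessian -/

/-- Boundary data of the Euclidean EPRL vertex with Barbero-Immirzi parameter `γ`. The five
tetrahedra are labelled by `Fin 5`; `a ≠ b` label the face shared by the tetrahedra `a` and `b`.
Values at `a = b` play no role. -/
structure BoundaryData (γ : ℝ) where
  /-- the spin `k_ab` of the face `ab` -/
  k : Fin 5 → Fin 5 → ℝ
  /-- `2 j⁺_ab` with `j⁺_ab = (1 + γ) k_ab / 2` -/
  twoJPlus : Fin 5 → Fin 5 → ℕ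
  /-- `2 j⁻_ab` with `j⁻_ab = (1 - γ) k_ab / 2` -/
  twoJMinus : Fin 5 → Fin 5 → ℕ
  /-- the unit spinor `ξ_ab` of the coherent state of tetrahedron `a` at its face `ab` -/
  ξ : Fin 5 → Fin 5 → Fin 2 → ℂ
  k_symm : ∀ a b, k a b = k b a
  k_pos : ∀ a b, a ≠ b → 0 < k a b
  twoJPlus_eq : ∀ a b, a ≠ b → (twoJPlus a b : ℝ) = (1 + γ) * k a b
  twoJMinus_eq : ∀ a b, a ≠ b → (twoJMinus a b : ℝ) = (1 - γ) * k a b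
  ξ_unit : ∀ a b, a ≠ b → star (ξ a b) ⬝ᵥ ξ a b = 1

/-- `⟨J ξ | g⁻¹ h η⟩`. -/
noncomputable def facePairing (g h : SU2) (ξ η : Fin 2 → ℂ) : ℂ :=
  star (spinorJ ξ) ⬝ᵥ (((g⁻¹ * h : SU2) : Matrix (Fin 2) (Fin 2) ℂ) *ᵥ η)

/-- The manifold of integration `∏_{a=1}^4 Spin(4)` (the fifth group element is gauge fixed). -/
abbrev Config : Type := Fin 4 → Spin4

/-- All five group elements, the last one being `1`. -/
def Config.full (g : Config) : Fin 5 → Spin4 := Fin.snoc (α := fun _ => Spin4) g 1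

/-- The integrand of the gauge-fixed Euclidean EPRL vertex amplitude for `γ < 1`:
`∏_{a<b} ∏_± ⟨J ξ_ab | (g_a^±)⁻¹ g_b^± ξ_ba⟩^(2 j_ab^±)`. -/
noncomputable def integrand {γ : ℝ} (D : BoundaryData γ) (g : Config) : ℂ :=
  ∏ a : Fin 5, ∏ b ∈ Finset.Ioi a,
    facePairing (g.full a).1 (g.full b).1 (D.ξ a b) (D.ξ b a) ^ D.twoJPlus a b *
      facePairing (g.full a).2 (g.full b).2 (D.ξ a b) (D.ξ b a) ^ D.twoJMinus a b

/-- The tangent space `⊕_{a=1}^4 (ℝ³ ⊕ ℝ³)` of `∏_{a=1}^4 Spin(4)`. -/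
abbrev Tangent : Type := Fin 4 → (Fin 3 → ℝ) × (Fin 3 → ℝ)

/-- The exponential chart `v ↦ (exp(v_a) g_a)_a` around `g`. -/
noncomputable def chart (g : Config) (v : Tangent) : Config :=
  fun a => (expSU2 (v a).1 * (g a).1, expSU2 (v a).2 * (g a).2)

/-- `S` is (a branch of) the action near `g`: it is twice continuously differentiable at `g` and
`exp (i S)` is the integrand of the amplitude in a neighbourhood of `g`. -/
structure IsActionNear {γ : ℝ} (D : BoundaryData γ) (S : Config → ℂ) (g : Config) : Prop where
  contDiffAt : ContDiffAt ℝ 2 (fun v => S (chart g v)) 0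
  exp_eq : ∀ᶠ h in 𝓝 g, Complex.exp (Complex.I * S h) = integrand D h

/-- `g` is a stationary point of `S`: the first derivative of `S` vanishes at `g`. -/
def IsStationary (S : Config → ℂ) (g : Config) : Prop :=
  HasFDerivAt (𝕜 := ℝ) (fun v => S (chart g v)) 0 0

/-- The Hessian of `S` at `g`, a complex valued real bilinear form on the tangent space. -/
noncomputable def hessian (S : Config → ℂ) (g : Config) : Tangent →L[ℝ] Tangent →L[ℝ] ℂ :=
  fderiv ℝ (fderiv ℝ (fun v => S (chart g v))) 0

/-- Nondegeneracy of a complex valued real bilinear form, extended bilinearly to the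
complexified space: no nonzero complex vector `x + i y` annihilates it. -/
def Nondegenerate (H : Tangent →L[ℝ] Tangent →L[ℝ] ℂ) : Prop :=
  ∀ x y : Tangent, (∀ w : Tangent, H w x + Complex.I * H w y = 0) → x = 0 ∧ y = 0

/-! ## Nondegenerate 4-simplices -/

/-- Euclidean `ℝ⁴`. -/
abbrev E4 : Type := EuclideanSpace ℝ (Fin 4)

/-- The bivector `u ∧ v`, as an antisymmetric matrix. -/
def wedge (u v : E4) : Matrix (Fin 4) (Fin 4) ℝ := fun i j => u i * v j - u j * v i

/-- The self-dual part of a bivector, in `ℝ³`. -/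
def selfDual (B : Matrix (Fin 4) (Fin 4) ℝ) : Fin 3 → ℝ :=
  ![B 2 3 + B 0 1, B 3 1 + B 0 2, B 1 2 + B 0 3]

/-- The anti-self-dual part of a bivector, in `ℝ³`. -/
def antiSelfDual (B : Matrix (Fin 4) (Fin 4) ℝ) : Fin 3 → ℝ :=
  ![B 2 3 - B 0 1, B 3 1 - B 0 2, B 1 2 - B 0 3]

/-- For a permutation `s` of the five labels `a, b, c, d, e = s 0, …, s 4`, the geometric (area)
bivector `B_ab` of the 4-simplex: the triangle shared by the tetrahedra opposite to the vertices
`a` and `b` is the one with vertices `c, d, e`, and its area bivector, with the orientation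
induced from the ordering of the vertices, is `sgn(s) (1/2) (p_d - p_c) ∧ (p_e - p_c)`.
It depends on `a` and `b` only. -/
noncomputable def faceBivector (Δ : Affine.Simplex ℝ E4 4) (s : Equiv.Perm (Fin 5)) :
    Matrix (Fin 4) (Fin 4) ℝ :=
  (((Equiv.Perm.sign s : ℤ) : ℝ) / 2) •
    wedge (Δ.points (s 3) - Δ.points (s 2)) (Δ.points (s 4) - Δ.points (s 2))

/-- The point `g` corresponds to the nondegenerate 4-simplex `Δ`: up to a global sign, the
bivectors with self-dual and anti-self-dual parts `k_ab g_a^± n_ab` are the geometric bivectors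
of `Δ`. Here `g_a^± n_ab` is the vector of the spinor `g_a^± ξ_ab`. -/
def CorrespondsTo {γ : ℝ} (D : BoundaryData γ) (g : Config) (Δ : Affine.Simplex ℝ E4 4) : Prop :=
  ∃ μ : ℝ, (μ = 1 ∨ μ = -1) ∧ ∀ s : Equiv.Perm (Fin 5),
    selfDual (faceBivector Δ s) =
      (μ * D.k (s 0) (s 1)) •
        spinorVec ((g.full (s 0)).1.1 *ᵥ D.ξ (s 0) (s 1)) ∧
    antiSelfDual (faceBivector Δ s) =
      (μ * D.k (s 0) (s 1)) •
        spinorVec ((g.full (s 0)).2.1 *ᵥ D.ξ (s 0) (s 1))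

end EPRL

/-!
Along a line `t ↦ exp(t v) g` the modulus of the integrand is `exp (Re (i S))`, so `Re (i ∂²S (v, v))`
is the second variation of `log |integrand|`. The proof uses only this real part.

* Each face factor has modulus at most `1`, and modulus `1` at `g`: opposite orientations of a face
  have opposite bivectors, so the vectors `g_a n_ab` and `g_b n_ba` are opposite
  (`norm_integrand_eq_one`). Hence the form `v ↦ Re (i ∂²S (v, v))` is nonpositive
  (`re_I_mul_hessian_nonpos`).
* If it vanishes at `v`, then the square of the modulus of every face factor is `1 - o(t²)`. For
  unit spinors `|⟨J ξ | χ⟩|² = 1 - |⟨ξ | χ⟩|²`, so the derivative of `⟨ξ | χ(t)⟩` is zero,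
  which says that `v_b - v_a` is parallel to `g_a n_ab`, that is, to the (anti-)self-dual part of the
  bivector `B_ab` (`exists_sub_eq_smul_of_isLittleO`).
* The three triangles of the 4-simplex at one edge `u` have bivectors `w ∧ u` with vectors `w` that
  are linearly independent modulo `u`. A simple bivector with vanishing self-dual part is zero, so
  the self-dual parts of these three bivectors are linearly independent as well. As the three
  differences of `v` around the triangle of the corresponding tetrahedra add up to zero, each is
  zero (`eq_of_forall_sub_eq_smul`). So `v` is constant, and the gauge fixing makes it zero
  (`eq_zero_of_re_I_mul_hessian_eq_zero`): the form is negative definite.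
* If `x + i y` annihilates the symmetric form `∂²S`, then pairing it with `x - i y` gives
  `∂²S (x, x) + ∂²S (y, y) = 0`, and definiteness gives `x = y = 0`.
-/

namespace EPRL

/-! ### Spinors and their vectors -/

theorem norm_sq_pairing_add_norm_sq_pairing_spinorJ (ξ χ : Fin 2 → ℂ) :
    ‖star ξ ⬝ᵥ χ‖ ^ 2 + ‖star (spinorJ ξ) ⬝ᵥ χ‖ ^ 2 =
      (star ξ ⬝ᵥ ξ).re * (star χ ⬝ᵥ χ).re := by
  simp only [← Complex.normSq_eq_norm_sq, Complex.normSq_apply]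
  simp [spinorJ, dotProduct, Fin.sum_univ_two]
  ring

theorem norm_sq_pairing_eq (α β : Fin 2 → ℂ) :
    ‖star α ⬝ᵥ β‖ ^ 2 =
      ((star α ⬝ᵥ α).re * (star β ⬝ᵥ β).re + spinorVec α ⬝ᵥ spinorVec β) / 2 := by
  simp only [← Complex.normSq_eq_norm_sq, Complex.normSq_apply]
  simp [spinorVec, pauli, Matrix.mulVec, dotProduct, Fin.sum_univ_two, Fin.sum_univ_three]
  ring

theorem spinorVec_dotProduct_self (α : Fin 2 → ℂ) :
    spinorVec α ⬝ᵥ spinorVec α = (star α ⬝ᵥ α).re ^ 2 := by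
  simp [spinorVec, pauli, Matrix.mulVec, dotProduct, Fin.sum_univ_two, Fin.sum_univ_three]
  ring

/-- The real part of `∑ⱼ uⱼ tr (σⱼ ββ† σᵢ αα†) / 4`, where `αα†` and `ββ†` are combinations of `1` and
of the Pauli matrices with coefficients `spinorVec α` and `spinorVec β`. -/
theorem re_pairing_su2Mat_mul_conj (α β : Fin 2 → ℂ) (u : Fin 3 → ℝ) (i : Fin 3) :
    ((star α ⬝ᵥ (su2Mat u *ᵥ β)) * star (star α ⬝ᵥ (((Complex.I / 2) • pauli i) *ᵥ β))).re =
      (((star α ⬝ᵥ α).re * (star β ⬝ᵥ β).re - spinorVec α ⬝ᵥ spinorVec β) * u i +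
        (u ⬝ᵥ spinorVec β) * spinorVec α i + (u ⬝ᵥ spinorVec α) * spinorVec β i) / 8 := by
  fin_cases i <;>
  · simp [su2Mat, spinorVec, pauli, Matrix.mulVec, dotProduct, Fin.sum_univ_two,
      Fin.sum_univ_three]
    ring

/-- If `α ⊥ β` are opposite on the Bloch sphere, then the only directions `u` for which `u · σ` has
no matrix element between them are those along their common axis. -/
theorem eq_smul_spinorVec_of_pairing_su2Mat_eq_zero {α β : Fin 2 → ℂ}
    (hα : star α ⬝ᵥ α = 1) (hβ : star β ⬝ᵥ β = 1) (hopp : spinorVec β = -spinorVec α)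
    {u : Fin 3 → ℝ} (hu : star α ⬝ᵥ (su2Mat u *ᵥ β) = 0) :
    u = (u ⬝ᵥ spinorVec α) • spinorVec α := by
  ext i
  have h := re_pairing_su2Mat_mul_conj α β u i
  have hn := spinorVec_dotProduct_self α
  rw [hu, hopp, hα, hβ] at h
  rw [hα] at hn
  simp only [zero_mul, Complex.zero_re, Complex.one_re, dotProduct_neg, hn, Pi.neg_apply] at h
  simp only [Pi.smul_apply, smul_eq_mul]
  linarith

theorem pairing_eq_zero_of_spinorVec_eq_neg {α β : Fin 2 → ℂ}
    (hα : star α ⬝ᵥ α = 1) (hβ : star β ⬝ᵥ β = 1) (hopp : spinorVec β = -spinorVec α) :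
    star α ⬝ᵥ β = 0 := by
  have h := norm_sq_pairing_eq α β
  have hn := spinorVec_dotProduct_self α
  rw [hα] at hn
  rw [hopp, hα, hβ, dotProduct_neg, hn] at h
  simpa using h

/-! ### Face pairings -/

theorem star_mulVec_dotProduct_mulVec (U : SU2) (ξ η : Fin 2 → ℂ) :
    star (U.1 *ᵥ ξ) ⬝ᵥ (U.1 *ᵥ η) = star ξ ⬝ᵥ η := by
  have hU : U.1ᴴ * U.1 = 1 :=
    Matrix.mem_unitaryGroup_iff'.1 (Matrix.mem_specialUnitaryGroup_iff.1 U.2).1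
  rw [Matrix.star_mulVec, Matrix.dotProduct_mulVec, Matrix.vecMul_vecMul, hU, Matrix.vecMul_one]

theorem coe_inv_mul (g h : SU2) : ((g⁻¹ * h : SU2) : Matrix (Fin 2) (Fin 2) ℂ) = g.1ᴴ * h.1 := rfl

theorem pairing_inv_mul (g h : SU2) (ξ η : Fin 2 → ℂ) :
    star ξ ⬝ᵥ (((g⁻¹ * h : SU2) : Matrix (Fin 2) (Fin 2) ℂ) *ᵥ η) =
      star (g.1 *ᵥ ξ) ⬝ᵥ (h.1 *ᵥ η) := by
  rw [coe_inv_mul, Matrix.star_mulVec, Matrix.dotProduct_mulVec, Matrix.dotProduct_mulVec,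
    Matrix.vecMul_vecMul]

/-- The unit vector `g⁻¹ h η` has components `⟨J ξ | g⁻¹ h η⟩` and `⟨ξ | g⁻¹ h η⟩` in the orthonormal
basis `J ξ, ξ`. -/
theorem norm_sq_facePairing (g h : SU2) {ξ η : Fin 2 → ℂ}
    (hξ : star ξ ⬝ᵥ ξ = 1) (hη : star η ⬝ᵥ η = 1) :
    ‖facePairing g h ξ η‖ ^ 2 = 1 - ‖star (g.1 *ᵥ ξ) ⬝ᵥ (h.1 *ᵥ η)‖ ^ 2 := by
  have h1 := norm_sq_pairing_add_norm_sq_pairing_spinorJ ξ (((g⁻¹ * h : SU2) : Matrix _ _ ℂ) *ᵥ η)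
  rw [star_mulVec_dotProduct_mulVec, hξ, hη, pairing_inv_mul] at h1
  simp only [Complex.one_re, one_mul] at h1
  unfold facePairing
  linarith

theorem norm_facePairing_le_one (g h : SU2) {ξ η : Fin 2 → ℂ}
    (hξ : star ξ ⬝ᵥ ξ = 1) (hη : star η ⬝ᵥ η = 1) : ‖facePairing g h ξ η‖ ≤ 1 := by
  have := norm_sq_facePairing g h hξ hη
  nlinarith [norm_nonneg (facePairing g h ξ η), sq_nonneg ‖star (g.1 *ᵥ ξ) ⬝ᵥ (h.1 *ᵥ η)‖]

theorem norm_facePairing_eq_one (g h : SU2) {ξ η : Fin 2 → ℂ}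
    (hξ : star ξ ⬝ᵥ ξ = 1) (hη : star η ⬝ᵥ η = 1)
    (hopp : spinorVec (h.1 *ᵥ η) = -spinorVec (g.1 *ᵥ ξ)) : ‖facePairing g h ξ η‖ = 1 := by
  have h1 := norm_sq_facePairing g h hξ hη
  rw [pairing_eq_zero_of_spinorVec_eq_neg (by rwa [star_mulVec_dotProduct_mulVec])
    (by rwa [star_mulVec_dotProduct_mulVec]) hopp] at h1
  have h2 : ‖facePairing g h ξ η‖ ^ 2 = 1 := by simpa using h1
  exact (pow_eq_one_iff_of_nonneg (norm_nonneg _) two_ne_zero).1 h2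

/-! ### Variation of a face pairing along the exponential map -/

theorem su2Mat_smul (t : ℝ) (x : Fin 3 → ℝ) : su2Mat (t • x) = t • su2Mat x := by
  ext i j
  simp [su2Mat, Fin.sum_univ_three]
  ring

theorem su2Mat_sub (x y : Fin 3 → ℝ) : su2Mat (x - y) = su2Mat x - su2Mat y := by
  ext i j
  simp [su2Mat, Fin.sum_univ_three]
  ring

theorem expSU2_zero : expSU2 0 = 1 := by
  ext1
  have : su2Mat 0 = 0 := by simp [su2Mat]
  simp [expSU2, this]

theorem continuous_expSU2 : Continuous expSU2 := by
  refine Continuous.subtype_mk ?_ _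
  let _ : NormedRing (Matrix (Fin 2) (Fin 2) ℂ) := Matrix.linftyOpNormedRing
  let _ : NormedAlgebra ℂ (Matrix (Fin 2) (Fin 2) ℂ) := Matrix.linftyOpNormedAlgebra
  let _ : NormedAlgebra ℚ (Matrix (Fin 2) (Fin 2) ℂ) := NormedAlgebra.restrictScalars ℚ ℂ _
  have : CompleteSpace (Matrix (Fin 2) (Fin 2) ℂ) :=
    inferInstanceAs (CompleteSpace (Fin 2 → Fin 2 → ℂ))
  have h : Continuous su2Mat := by
    unfold su2Mat
    fun_prop
  exact NormedSpace.exp_continuous.comp h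

theorem hasDerivAt_exp_smul_mul_exp_smul (A B : Matrix (Fin 2) (Fin 2) ℂ) (i j : Fin 2) :
    HasDerivAt (fun t : ℝ => (NormedSpace.exp (t • A) * NormedSpace.exp (t • B)) i j)
      ((A + B) i j) 0 := by
  let _ : NormedRing (Matrix (Fin 2) (Fin 2) ℂ) := Matrix.linftyOpNormedRing
  let _ : NormedAlgebra ℝ (Matrix (Fin 2) (Fin 2) ℂ) := Matrix.linftyOpNormedAlgebra
  have h := (hasDerivAt_exp_smul_const A (0 : ℝ)).mul (hasDerivAt_exp_smul_const B (0 : ℝ))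
  simp only [zero_smul, NormedSpace.exp_zero, one_mul, mul_one] at h
  exact ((Matrix.entryLinearMap ℝ ℂ i j).toContinuousLinearMap.hasFDerivAt.comp_hasDerivAt 0 h)

/-- First-order variation of `⟨α | exp(-tx) exp(ty) β⟩`. -/
theorem hasDerivAt_pairing_expSU2 (g h : SU2) (ξ η : Fin 2 → ℂ) (x y : Fin 3 → ℝ) :
    HasDerivAt (fun t : ℝ => star ((expSU2 (t • x) * g).1 *ᵥ ξ) ⬝ᵥ ((expSU2 (t • y) * h).1 *ᵥ η))
      (star (g.1 *ᵥ ξ) ⬝ᵥ (su2Mat (y - x) *ᵥ (h.1 *ᵥ η))) 0 := by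
  have key : ∀ t : ℝ,
      star ((expSU2 (t • x) * g).1 *ᵥ ξ) ⬝ᵥ ((expSU2 (t • y) * h).1 *ᵥ η) =
      star (g.1 *ᵥ ξ) ⬝ᵥ
        ((NormedSpace.exp (t • -su2Mat x) * NormedSpace.exp (t • su2Mat y)) *ᵥ (h.1 *ᵥ η)) := by
    intro t
    have hx : (expSU2 (t • x)).1ᴴ = NormedSpace.exp (t • -su2Mat x) := by
      simp only [expSU2]
      rw [← Matrix.exp_conjTranspose, su2Mat_conjTranspose, su2Mat_smul, smul_neg]
    have hy : (expSU2 (t • y)).1 = NormedSpace.exp (t • su2Mat y) := by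
      simp only [expSU2]
      rw [su2Mat_smul]
    rw [← hx, ← hy]
    simp only [Submonoid.coe_mul, ← Matrix.mulVec_mulVec]
    rw [Matrix.star_mulVec (expSU2 (t • x)).1, ← Matrix.dotProduct_mulVec]
  simp only [key]
  have hd := hasDerivAt_exp_smul_mul_exp_smul (-su2Mat x) (su2Mat y)
  have : su2Mat (y - x) = -su2Mat x + su2Mat y := by rw [su2Mat_sub]; abel
  rw [this]
  simp only [dotProduct, Matrix.mulVec]
  exact HasDerivAt.fun_sum fun i _ => (HasDerivAt.fun_sum fun j _ =>
    (hd i j).mul_const _).const_mul _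

/-- If the modulus of the pairing of a face stays maximal to second order along `exp(tx) g`,
`exp(ty) h`, then `y - x` is parallel to the vector of the face: `1 - |⟨J ξ | ·⟩|²` is the square of
the modulus of `⟨ξ | ·⟩`, whose derivative at `0` therefore vanishes. -/
theorem exists_sub_eq_smul_of_isLittleO (g h : SU2) {ξ η : Fin 2 → ℂ} (x y : Fin 3 → ℝ)
    (hξ : star ξ ⬝ᵥ ξ = 1) (hη : star η ⬝ᵥ η = 1)
    (hopp : spinorVec (h.1 *ᵥ η) = -spinorVec (g.1 *ᵥ ξ))
    (ho : (fun t : ℝ => 1 - ‖facePairing (expSU2 (t • x) * g) (expSU2 (t • y) * h) ξ η‖ ^ 2)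
      =o[𝓝 0] fun t => t ^ 2) :
    ∃ c : ℝ, y - x = c • spinorVec (g.1 *ᵥ ξ) := by
  have hα : star (g.1 *ᵥ ξ) ⬝ᵥ (g.1 *ᵥ ξ) = 1 := by rwa [star_mulVec_dotProduct_mulVec]
  have hβ : star (h.1 *ᵥ η) ⬝ᵥ (h.1 *ᵥ η) = 1 := by rwa [star_mulVec_dotProduct_mulVec]
  have hd := hasDerivAt_pairing_expSU2 g h ξ η x y
  simp only [norm_sq_facePairing _ _ hξ hη, sub_sub_cancel] at ho
  have ho' := (Asymptotics.IsLittleO.of_pow ho two_ne_zero).of_norm_left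
  have hd0 : HasDerivAt (fun t : ℝ =>
      star ((expSU2 (t • x) * g).1 *ᵥ ξ) ⬝ᵥ ((expSU2 (t • y) * h).1 *ᵥ η)) 0 0 := by
    rw [hasDerivAt_iff_isLittleO]
    simpa only [zero_smul, expSU2_zero, one_mul, pairing_eq_zero_of_spinorVec_eq_neg hα hβ hopp,
      sub_zero, smul_zero] using ho'
  exact ⟨_, eq_smul_spinorVec_of_pairing_su2Mat_eq_zero hα hβ hopp (hd.unique hd0)⟩

/-! ### Bivectors and the rigidity of the 4-simplex -/

/-- A simple bivector `v ∧ u` with vanishing self-dual part is zero, that is, `v` is parallel to `u`.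
In quaternions: the self-dual part is the imaginary part of a product of `v` with the conjugate of
`u`, and multiplication by `u` recovers `|u|² v`. -/
theorem smul_eq_smul_of_selfDual_wedge_eq_zero {v u : E4} (h : selfDual (wedge v u) = 0) :
    (u ⬝ᵥ u) • v = (v ⬝ᵥ u) • u := by
  have h0 := congrFun h 0
  have h1 := congrFun h 1
  have h2 := congrFun h 2
  simp [selfDual, wedge] at h0 h1 h2
  ext i
  simp [dotProduct, Fin.sum_univ_four]
  fin_cases i <;> simp
  · linear_combination u 1 * h0 + u 2 * h1 + u 3 * h2
  · linear_combination -u 0 * h0 - u 3 * h1 + u 2 * h2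
  · linear_combination -u 0 * h1 - u 1 * h2 + u 3 * h0
  · linear_combination -u 0 * h2 - u 2 * h0 + u 1 * h1

theorem smul_eq_smul_of_antiSelfDual_wedge_eq_zero {v u : E4} (h : antiSelfDual (wedge v u) = 0) :
    (u ⬝ᵥ u) • v = (v ⬝ᵥ u) • u := by
  have h0 := congrFun h 0
  have h1 := congrFun h 1
  have h2 := congrFun h 2
  simp [antiSelfDual, wedge] at h0 h1 h2
  ext i
  simp [dotProduct, Fin.sum_univ_four]
  fin_cases i <;> simp
  · linear_combination -u 1 * h0 - u 2 * h1 - u 3 * h2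
  · linear_combination u 0 * h0 - u 3 * h1 + u 2 * h2
  · linear_combination u 0 * h1 - u 1 * h2 + u 3 * h0
  · linear_combination u 0 * h2 - u 2 * h0 + u 1 * h1

theorem isLinearMap_selfDual : IsLinearMap ℝ selfDual where
  map_add A B := by ext i; fin_cases i <;> simp [selfDual] <;> ring
  map_smul c A := by ext i; fin_cases i <;> simp [selfDual] <;> ring

theorem isLinearMap_antiSelfDual : IsLinearMap ℝ antiSelfDual where
  map_add A B := by ext i; fin_cases i <;> simp [antiSelfDual] <;> ring
  map_smul c A := by ext i; fin_cases i <;> simp [antiSelfDual] <;> ring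

/-- Replacing the edge `pr` of a triangle by `qr` does not change its area bivector. -/
theorem wedge_sub_sub_eq (p q r : E4) : wedge (q - p) (r - p) = wedge (q - p) (r - q) := by
  ext i j
  simp [wedge]
  ring

theorem faceBivector_mul_swap (Δ : Affine.Simplex ℝ E4 4) (s : Equiv.Perm (Fin 5)) :
    faceBivector Δ (s * Equiv.swap 0 1) = -faceBivector Δ s := by
  have h2 : (Equiv.swap (0 : Fin 5) 1) 2 = 2 := by decide
  have h3 : (Equiv.swap (0 : Fin 5) 1) 3 = 3 := by decide
  have h4 : (Equiv.swap (0 : Fin 5) 1) 4 = 4 := by decide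
  simp [faceBivector, h2, h3, h4, neg_div]

theorem exists_perm_zero_one {a b : Fin 5} (h : a ≠ b) :
    ∃ s : Equiv.Perm (Fin 5), s 0 = a ∧ s 1 = b := by
  have h0 : (0 : Fin 5) ≠ Equiv.swap 0 a b := fun h' => h <| by
    rw [eq_comm, Equiv.swap_apply_eq_iff, Equiv.swap_apply_left] at h'
    exact h'.symm
  refine ⟨Equiv.swap 0 a * Equiv.swap 1 (Equiv.swap 0 a b), ?_, ?_⟩
  · rw [Equiv.Perm.mul_apply, Equiv.swap_apply_of_ne_of_ne (by decide) h0, Equiv.swap_apply_left]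
  · rw [Equiv.Perm.mul_apply, Equiv.swap_apply_left, Equiv.swap_apply_self]

/-- Rigidity of the vectors of a nondegenerate 4-simplex. The three faces of a 4-simplex which have
an edge `u` in common have bivectors `w ∧ u` with linearly independent `w`, so that (by `hw`) their
self-dual parts are linearly independent; hence the three differences of `x` around
the corresponding triangle, which add up to zero, vanish. -/
theorem eq_of_forall_sub_eq_smul {P : Matrix (Fin 4) (Fin 4) ℝ → Fin 3 → ℝ}
    (hP : IsLinearMap ℝ P)
    (hw : ∀ v u : E4, P (wedge v u) = 0 → (u ⬝ᵥ u) • v = (v ⬝ᵥ u) • u)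
    (Δ : Affine.Simplex ℝ E4 4) (x : Fin 5 → Fin 3 → ℝ)
    (hx : ∀ s : Equiv.Perm (Fin 5), ∃ c : ℝ, x (s 1) - x (s 0) = c • P (faceBivector Δ s))
    (a b : Fin 5) : x a = x b := by
  by_cases hab : a = b
  · rw [hab]
  obtain ⟨s, rfl, rfl⟩ := exists_perm_zero_one hab
  have hx' : ∀ s : Equiv.Perm (Fin 5), ∃ c : ℝ, x (s 1) - x (s 0) =
      c • P (wedge (Δ.points (s 3) - Δ.points (s 2)) (Δ.points (s 4) - Δ.points (s 3))) := by
    intro s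
    obtain ⟨c, hc⟩ := hx s
    rw [faceBivector, hP.map_smul, smul_smul, wedge_sub_sub_eq] at hc
    exact ⟨_, hc⟩
  -- `s`, `s ρ`, `s ρ²` describe the three faces that contain the edge from `s 3` to `s 4`.
  set ρ : Equiv.Perm (Fin 5) := Equiv.swap 0 1 * Equiv.swap 1 2
  obtain ⟨c₂, h₂⟩ := hx' s
  obtain ⟨c₀, h₀⟩ := hx' (s * ρ)
  obtain ⟨c₁, h₁⟩ := hx' (s * ρ * ρ)
  have r0 : ρ 0 = 1 := by decide
  have r1 : ρ 1 = 2 := by decide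
  have r2 : ρ 2 = 0 := by decide
  have r3 : ρ 3 = 3 := by decide
  have r4 : ρ 4 = 4 := by decide
  simp only [Equiv.Perm.mul_apply, r0, r1, r2, r3, r4] at h₀ h₁
  have hq : AffineIndependent ℝ fun i => Δ.points (s i) :=
    Δ.independent.comp_embedding s.toEmbedding
  generalize hqd : (fun i => Δ.points (s i)) = q at hq
  have hqi : ∀ i, Δ.points (s i) = q i := fun i => congrFun hqd i
  simp only [hqi] at h₀ h₁ h₂
  set u := q 4 - q 3 with hu
  set v := c₀ • (q 3 - q 0) + c₁ • (q 3 - q 1) + c₂ • (q 3 - q 2) with hv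
  have hwv : wedge v u = c₀ • wedge (q 3 - q 0) u + c₁ • wedge (q 3 - q 1) u
      + c₂ • wedge (q 3 - q 2) u := by
    ext i j
    simp [wedge, hv]
    ring
  have hPv : P (wedge v u) = 0 := by
    rw [hwv, hP.map_add, hP.map_add, hP.map_smul, hP.map_smul, hP.map_smul, ← h₀, ← h₁, ← h₂]
    abel
  have hvu := hw v u hPv
  have hu0 : u ⬝ᵥ u ≠ 0 := by
    intro h
    have : (u : Fin 4 → ℝ) = 0 := dotProduct_self_eq_zero.1 h
    have h43 : q 4 = q 3 := by
      rw [← sub_eq_zero, ← hu]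
      ext i
      exact congrFun this i
    exact absurd (hq.injective h43) (by decide)
  -- `(u ⬝ u) v = (v ⬝ u) u` is an affine relation between the vertices.
  have hlin := (affineIndependent_iff.1 hq) Finset.univ
    ![-((u ⬝ᵥ u) * c₀), -((u ⬝ᵥ u) * c₁), -((u ⬝ᵥ u) * c₂),
      (u ⬝ᵥ u) * (c₀ + c₁ + c₂) + v ⬝ᵥ u, -(v ⬝ᵥ u)]
    (by simp [Fin.sum_univ_five]; ring)
    (by
      rw [← sub_eq_zero] at hvu
      rw [← hvu]
      simp only [Fin.sum_univ_five]
      simp only [Matrix.cons_val]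
      generalize u ⬝ᵥ u = A
      generalize v ⬝ᵥ u = B
      rw [hv, hu]
      module) 2 (Finset.mem_univ _)
  have hc₂ : c₂ = 0 := by simpa [hu0] using hlin
  rw [hc₂, zero_smul, sub_eq_zero] at h₂
  exact h₂.symm

/-! ### Taylor expansion -/

/-- Second-order Taylor expansion along a line at a critical point. -/
theorem isLittleO_sub_fderiv_fderiv {E : Type*} [NormedAddCommGroup E] [NormedSpace ℝ E]
    {F : E → ℂ} (hF : ContDiffAt ℝ 2 F 0) (h0 : fderiv ℝ F 0 = 0) (v : E) :
    (fun t : ℝ => F (t • v) - F 0 - ((t ^ 2 / 2 : ℝ) : ℂ) * fderiv ℝ (fderiv ℝ F) 0 v v)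
      =o[𝓝 0] fun t => t ^ 2 := by
  set H := fderiv ℝ (fderiv ℝ F) 0 with hH
  have hd : ∀ᶠ w in 𝓝 (0 : E), DifferentiableAt ℝ F w :=
    (hF.eventually (by simp)).mono fun w hw => hw.differentiableAt (by norm_num)
  have hH' : HasFDerivAt (fderiv ℝ F) H 0 :=
    ((hF.fderiv_right (m := 1) (by norm_num)).differentiableAt (by norm_num)).hasFDerivAt
  have hline : Filter.Tendsto (fun t : ℝ => t • v) (𝓝 0) (𝓝 0) := by
    have : Continuous fun t : ℝ => t • v := by fun_prop
    simpa using this.tendsto 0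
  have hd' : ∀ᶠ t : ℝ in 𝓝 (0 : ℝ), HasDerivAt
      (fun t : ℝ => F (t • v) - F 0 - ((t ^ 2 / 2 : ℝ) : ℂ) * H v v)
      (fderiv ℝ F (t • v) v - (t : ℂ) * H v v) t := by
    filter_upwards [hline.eventually hd] with t ht
    have h1 : HasDerivAt (fun t : ℝ => F (t • v)) (fderiv ℝ F (t • v) v) t := by
      have := ht.hasFDerivAt.comp_hasDerivAt t ((hasDerivAt_id t).smul_const v)
      rw [one_smul] at this
      exact this
    have h2 : HasDerivAt (fun t : ℝ => ((t ^ 2 / 2 : ℝ) : ℂ)) (t : ℂ) t := by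
      have := ((hasDerivAt_pow 2 t).div_const 2).ofReal_comp
      simpa using this
    exact (h1.sub_const _).sub (h2.mul_const _)
  have hder : (fun t : ℝ => fderiv ℝ F (t • v) v - (t : ℂ) * H v v) =o[𝓝 0] fun t : ℝ => t := by
    have h1 : HasDerivAt (fun t : ℝ => fderiv ℝ F (t • v) v) (H v v) 0 := by
      have hl : HasDerivAt (fun t : ℝ => t • v) v 0 := by
        simpa using (hasDerivAt_id (0 : ℝ)).smul_const v
      have h2 := HasFDerivAt.comp_hasDerivAt (x := (0 : ℝ)) (l := fderiv ℝ F)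
        (f := fun t : ℝ => t • v) (l' := H) (by simpa using hH') hl
      exact h2.clm_apply (hasDerivAt_const 0 v) |>.congr_deriv (by simp)
    rw [hasDerivAt_iff_isLittleO] at h1
    simpa [h0] using h1
  rw [Asymptotics.isLittleO_iff] at hder ⊢
  intro c hc
  obtain ⟨δ, hδ, hball⟩ := Metric.eventually_nhds_iff_ball.1 (hd'.and (hder hc))
  filter_upwards [Metric.ball_mem_nhds (0 : ℝ) hδ] with t ht
  have hsub : ∀ r ∈ Metric.closedBall (0 : ℝ) |t|, r ∈ Metric.ball (0 : ℝ) δ := by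
    intro r hr
    simp at hr ht ⊢
    exact hr.trans_lt ht
  have := (convex_closedBall (0 : ℝ) |t|).norm_image_sub_le_of_norm_hasDerivWithin_le (C := c * |t|)
    (fun r hr => (hball r (hsub r hr)).1.hasDerivWithinAt)
    (fun r hr => (hball r (hsub r hr)).2.trans
      (mul_le_mul_of_nonneg_left (by simpa using hr) hc.le))
    (Metric.mem_closedBall_self (abs_nonneg t)) (y := t) (by simp)
  simp at this
  simpa [sq, mul_assoc] using this

/-! ### The exponential chart -/

/-- The tangent vector at all five tetrahedra; it vanishes at the gauge-fixed one. -/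
def tangentFull (v : Tangent) : Fin 5 → (Fin 3 → ℝ) × (Fin 3 → ℝ) :=
  Fin.snoc (α := fun _ => (Fin 3 → ℝ) × (Fin 3 → ℝ)) v 0

theorem tangentFull_smul (t : ℝ) (v : Tangent) (a : Fin 5) :
    tangentFull (t • v) a = t • tangentFull v a := by
  refine Fin.lastCases ?_ (fun i => ?_) a
  · simp only [tangentFull, Fin.snoc_last, smul_zero]
  · simp only [tangentFull, Fin.snoc_castSucc, Pi.smul_apply]

theorem full_chart (g : Config) (v : Tangent) (a : Fin 5) :
    (chart g v).full a =
      (expSU2 (tangentFull v a).1 * (g.full a).1, expSU2 (tangentFull v a).2 * (g.full a).2) := by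
  refine Fin.lastCases ?_ (fun i => ?_) a
  · simp only [Config.full, tangentFull, Fin.snoc_last, Prod.fst_zero, Prod.snd_zero, expSU2_zero,
      Prod.fst_one, Prod.snd_one, mul_one]
    rfl
  · simp only [Config.full, tangentFull, Fin.snoc_castSucc, chart]

theorem chart_zero (g : Config) : chart g 0 = g := by
  funext a
  simp [chart, expSU2_zero]

theorem continuous_chart (g : Config) : Continuous (chart g) := by
  have := continuous_expSU2
  unfold chart
  fun_prop

/-! ### The modulus of the integrand -/

theorem prod_le_of_mem {ι : Type*} {s : Finset ι} {f : ι → ℝ} (h0 : ∀ i ∈ s, 0 ≤ f i)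
    (h1 : ∀ i ∈ s, f i ≤ 1) {i : ι} (hi : i ∈ s) : ∏ j ∈ s, f j ≤ f i := by
  classical
  rw [← Finset.mul_prod_erase s f hi]
  exact mul_le_of_le_one_right (h0 i hi) (Finset.prod_le_one
    (fun j hj => h0 j (Finset.mem_of_mem_erase hj)) fun j hj => h1 j (Finset.mem_of_mem_erase hj))

variable {γ : ℝ} (D : BoundaryData γ) (g : Config)

theorem norm_integrand : ‖integrand D g‖ =
    ∏ a : Fin 5, ∏ b ∈ Finset.Ioi a,
      ‖facePairing (g.full a).1 (g.full b).1 (D.ξ a b) (D.ξ b a)‖ ^ D.twoJPlus a b *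
      ‖facePairing (g.full a).2 (g.full b).2 (D.ξ a b) (D.ξ b a)‖ ^ D.twoJMinus a b := by
  simp only [integrand, norm_prod, norm_mul, norm_pow]

theorem norm_integrand_le {a b : Fin 5} (hab : a < b) : ‖integrand D g‖ ≤
      ‖facePairing (g.full a).1 (g.full b).1 (D.ξ a b) (D.ξ b a)‖ ^ D.twoJPlus a b *
      ‖facePairing (g.full a).2 (g.full b).2 (D.ξ a b) (D.ξ b a)‖ ^ D.twoJMinus a b := by
  rw [norm_integrand]
  have h1 : ∀ a : Fin 5, ∀ b ∈ Finset.Ioi a,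
      ‖facePairing (g.full a).1 (g.full b).1 (D.ξ a b) (D.ξ b a)‖ ^ D.twoJPlus a b *
      ‖facePairing (g.full a).2 (g.full b).2 (D.ξ a b) (D.ξ b a)‖ ^ D.twoJMinus a b ≤ 1 := by
    intro a b hb
    have hab : a ≠ b := (Finset.mem_Ioi.1 hb).ne
    exact mul_le_one₀
      (pow_le_one₀ (norm_nonneg _)
        (norm_facePairing_le_one _ _ (D.ξ_unit _ _ hab) (D.ξ_unit _ _ hab.symm)))
      (by positivity)
      (pow_le_one₀ (norm_nonneg _)
        (norm_facePairing_le_one _ _ (D.ξ_unit _ _ hab) (D.ξ_unit _ _ hab.symm)))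
  refine (prod_le_of_mem (fun a _ => Finset.prod_nonneg fun b _ => by positivity)
    (fun a _ => Finset.prod_le_one (fun b _ => by positivity) (h1 a)) (Finset.mem_univ a)).trans ?_
  exact prod_le_of_mem (fun b _ => by positivity) (h1 a) (Finset.mem_Ioi.2 hab)

variable {D g}

theorem norm_integrand_le_norm_facePairing_fst (hγ : 0 < γ) {a b : Fin 5} (hab : a < b) :
    ‖integrand D g‖ ≤ ‖facePairing (g.full a).1 (g.full b).1 (D.ξ a b) (D.ξ b a)‖ := by
  have hj : D.twoJPlus a b ≠ 0 := by
    have h := D.twoJPlus_eq a b hab.ne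
    have : 0 < (1 + γ) * D.k a b := mul_pos (by linarith) (D.k_pos a b hab.ne)
    intro h0
    rw [h0, Nat.cast_zero] at h
    linarith
  have hle := fun g h : SU2 =>
    norm_facePairing_le_one g h (D.ξ_unit a b hab.ne) (D.ξ_unit b a hab.ne')
  exact (norm_integrand_le D g hab).trans ((mul_le_of_le_one_right (by positivity)
    (pow_le_one₀ (norm_nonneg _) (hle _ _))).trans (pow_le_of_le_one (norm_nonneg _) (hle _ _) hj))

theorem norm_integrand_le_norm_facePairing_snd (hγ : γ < 1) {a b : Fin 5} (hab : a < b) :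
    ‖integrand D g‖ ≤ ‖facePairing (g.full a).2 (g.full b).2 (D.ξ a b) (D.ξ b a)‖ := by
  have hj : D.twoJMinus a b ≠ 0 := by
    have h := D.twoJMinus_eq a b hab.ne
    have : 0 < (1 - γ) * D.k a b := mul_pos (by linarith) (D.k_pos a b hab.ne)
    intro h0
    rw [h0, Nat.cast_zero] at h
    linarith
  have hle := fun g h : SU2 =>
    norm_facePairing_le_one g h (D.ξ_unit a b hab.ne) (D.ξ_unit b a hab.ne')
  exact (norm_integrand_le D g hab).trans ((mul_le_of_le_one_left (by positivity)
    (pow_le_one₀ (norm_nonneg _) (hle _ _))).trans (pow_le_of_le_one (norm_nonneg _) (hle _ _) hj))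

/-! ### One sector at a configuration of a nondegenerate 4-simplex -/

/-- The vectors of the two tetrahedra at a face are opposite, in one of the two sectors: `P` is
`selfDual` or `antiSelfDual`, and `G` the corresponding components of the group elements. -/
theorem spinorVec_eq_neg {P : Matrix (Fin 4) (Fin 4) ℝ → Fin 3 → ℝ} (hP : IsLinearMap ℝ P)
    {Δ : Affine.Simplex ℝ E4 4} {G : Fin 5 → SU2} {μ : ℝ} (hμ : μ = 1 ∨ μ = -1)
    (hg : ∀ s : Equiv.Perm (Fin 5), P (faceBivector Δ s) =
      (μ * D.k (s 0) (s 1)) • spinorVec ((G (s 0)).1 *ᵥ D.ξ (s 0) (s 1)))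
    {a b : Fin 5} (hab : a ≠ b) :
    spinorVec ((G b).1 *ᵥ D.ξ b a) = -spinorVec ((G a).1 *ᵥ D.ξ a b) := by
  obtain ⟨s, rfl, rfl⟩ := exists_perm_zero_one hab
  have h := hg (s * Equiv.swap 0 1)
  rw [faceBivector_mul_swap, hP.map_neg, hg s, Equiv.Perm.mul_apply, Equiv.Perm.mul_apply,
    Equiv.swap_apply_left, Equiv.swap_apply_right, D.k_symm (s 1) (s 0), ← smul_neg] at h
  have hk : μ * D.k (s 0) (s 1) ≠ 0 :=
    mul_ne_zero (by rcases hμ with rfl | rfl <;> norm_num) (D.k_pos _ _ hab).ne'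
  exact (smul_right_injective _ hk h).symm

/-- In one sector: if no face pairing decreases to second order along `exp(t x_a) G_a`, then `x` is
constant. -/
theorem eq_of_forall_isLittleO {P : Matrix (Fin 4) (Fin 4) ℝ → Fin 3 → ℝ} (hP : IsLinearMap ℝ P)
    (hw : ∀ v u : E4, P (wedge v u) = 0 → (u ⬝ᵥ u) • v = (v ⬝ᵥ u) • u)
    {Δ : Affine.Simplex ℝ E4 4} {G : Fin 5 → SU2} {μ : ℝ} (hμ : μ = 1 ∨ μ = -1)
    (hg : ∀ s : Equiv.Perm (Fin 5), P (faceBivector Δ s) =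
      (μ * D.k (s 0) (s 1)) • spinorVec ((G (s 0)).1 *ᵥ D.ξ (s 0) (s 1)))
    {x : Fin 5 → Fin 3 → ℝ}
    (ho : ∀ a b : Fin 5, a < b → (fun t : ℝ => 1 - ‖facePairing (expSU2 (t • x a) * G a)
      (expSU2 (t • x b) * G b) (D.ξ a b) (D.ξ b a)‖ ^ 2) =o[𝓝 0] fun t => t ^ 2)
    (a b : Fin 5) : x a = x b := by
  have hlt : ∀ a b : Fin 5, a < b → ∃ c : ℝ, x b - x a = c • spinorVec ((G a).1 *ᵥ D.ξ a b) :=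
    fun a b hab => exists_sub_eq_smul_of_isLittleO _ _ _ _ (D.ξ_unit _ _ hab.ne)
      (D.ξ_unit _ _ hab.ne') (spinorVec_eq_neg hP hμ hg hab.ne) (ho a b hab)
  have hne : ∀ a b : Fin 5, a ≠ b →
      ∃ c : ℝ, x b - x a = c • spinorVec ((G a).1 *ᵥ D.ξ a b) := by
    intro a b hab
    rcases lt_or_gt_of_ne hab with h | h
    · exact hlt a b h
    · obtain ⟨c, hc⟩ := hlt b a h
      refine ⟨c, ?_⟩
      rw [← neg_sub, hc, spinorVec_eq_neg hP hμ hg hab, smul_neg, neg_neg]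
  refine eq_of_forall_sub_eq_smul hP hw Δ x (fun s => ?_) a b
  have h01 : s 0 ≠ s 1 := fun h => absurd (s.injective h) (by decide)
  obtain ⟨c, hc⟩ := hne _ _ h01
  have hk : μ * D.k (s 0) (s 1) ≠ 0 :=
    mul_ne_zero (by rcases hμ with rfl | rfl <;> norm_num) (D.k_pos _ _ h01).ne'
  refine ⟨c / (μ * D.k (s 0) (s 1)), ?_⟩
  rw [hg s, smul_smul, div_mul_cancel₀ _ hk, hc]

/-! ### The real part of the second variation -/

theorem norm_integrand_eq_one {Δ : Affine.Simplex ℝ E4 4} (hg : CorrespondsTo D g Δ) :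
    ‖integrand D g‖ = 1 := by
  obtain ⟨μ, hμ, hs⟩ := hg
  rw [norm_integrand]
  refine Finset.prod_eq_one fun a _ => Finset.prod_eq_one fun b hb => ?_
  have hab : a ≠ b := (Finset.mem_Ioi.1 hb).ne
  rw [norm_facePairing_eq_one _ _ (D.ξ_unit _ _ hab) (D.ξ_unit _ _ hab.symm)
      (spinorVec_eq_neg (G := fun a => (g.full a).1) isLinearMap_selfDual hμ
        (fun s => (hs s).1) hab),
    norm_facePairing_eq_one _ _ (D.ξ_unit _ _ hab) (D.ξ_unit _ _ hab.symm)
      (spinorVec_eq_neg (G := fun a => (g.full a).2) isLinearMap_antiSelfDual hμ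
        (fun s => (hs s).2) hab), one_pow, one_pow, one_mul]

/-- Stationarity turns the Hessian into the second-order term of `log |integrand|`. -/
theorem exists_norm_integrand_eq_exp {S : Config → ℂ} (hS : IsActionNear D S g)
    (hstat : IsStationary S g) (h1 : ‖integrand D g‖ = 1) (v : Tangent) :
    ∃ r : ℝ → ℝ, r =o[𝓝 0] (fun t => t ^ 2) ∧ ∀ᶠ t : ℝ in 𝓝 0,
      ‖integrand D (chart g (t • v))‖ =
        Real.exp (t ^ 2 / 2 * (Complex.I * hessian S g v v).re + r t) := by
  have hT := isLittleO_sub_fderiv_fderiv hS.contDiffAt hstat.fderiv v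
  have hline : Filter.Tendsto (fun t : ℝ => chart g (t • v)) (𝓝 0) (𝓝 g) := by
    have : Continuous fun t : ℝ => chart g (t • v) :=
      (continuous_chart g).comp (by fun_prop)
    simpa [chart_zero] using this.tendsto 0
  have h0 : (Complex.I * S g).re = 0 := by
    rw [← hS.exp_eq.self_of_nhds, Complex.norm_exp] at h1
    exact Real.exp_eq_one_iff _ |>.1 h1
  refine ⟨fun t => (Complex.I * (S (chart g (t • v)) - S (chart g 0) -
    ((t ^ 2 / 2 : ℝ) : ℂ) * hessian S g v v)).re, ?_, ?_⟩
  · refine (Asymptotics.IsBigO.of_bound 1 (.of_forall fun t => ?_)).trans_isLittleO hT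
    rw [one_mul, Real.norm_eq_abs]
    refine (Complex.abs_re_le_norm _).trans ?_
    rw [norm_mul, Complex.norm_I, one_mul]
    rfl
  · filter_upwards [hline.eventually hS.exp_eq] with t ht
    rw [← ht, Complex.norm_exp, chart_zero]
    congr 1
    simp at h0 ⊢
    simp [h0, ← Complex.ofReal_pow]
    ring

/-- The second variation of `log |integrand|` is nonpositive, because `|integrand| ≤ 1`, with
equality at `g`. -/
theorem re_I_mul_hessian_nonpos {S : Config → ℂ} (hS : IsActionNear D S g)
    (hstat : IsStationary S g) (h1 : ‖integrand D g‖ = 1) (v : Tangent) :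
    (Complex.I * hessian S g v v).re ≤ 0 := by
  obtain ⟨r, hr, he⟩ := exists_norm_integrand_eq_exp hS hstat h1 v
  by_contra! hpos
  set q := (Complex.I * hessian S g v v).re
  have hr' := Asymptotics.isLittleO_iff.1 hr (c := q / 4) (by positivity)
  obtain ⟨t, ⟨⟨het, hrt⟩, ht⟩⟩ := ((he.and hr').filter_mono nhdsWithin_le_nhds |>.and
    (self_mem_nhdsWithin : Set.Ioi (0 : ℝ) ∈ 𝓝[>] 0)).exists
  have ht0 : (0 : ℝ) < t := ht
  have hle : ‖integrand D (chart g (t • v))‖ ≤ 1 :=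
    (norm_integrand_le D _ (show (0 : Fin 5) < 1 by decide)).trans <| mul_le_one₀
      (pow_le_one₀ (norm_nonneg _) (norm_facePairing_le_one _ _
        (D.ξ_unit _ _ (by decide)) (D.ξ_unit _ _ (by decide)))) (by positivity)
      (pow_le_one₀ (norm_nonneg _) (norm_facePairing_le_one _ _
        (D.ξ_unit _ _ (by decide)) (D.ξ_unit _ _ (by decide))))
  rw [het, Real.exp_le_one_iff] at hle
  rw [Real.norm_eq_abs, Real.norm_eq_abs, abs_of_pos (by positivity : 0 < t ^ 2)] at hrt
  have := (abs_le.1 hrt).1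
  nlinarith [mul_pos hpos (by positivity : 0 < t ^ 2)]

/-- The second variation of `log |integrand|` is negative definite. Along a direction in which it
vanishes, `log |integrand|` is `o(t²)`, hence so is the logarithm of every face factor, as none of
them exceeds `1` in modulus; then the rigidity of the 4-simplex applies in both sectors. -/
theorem eq_zero_of_re_I_mul_hessian_eq_zero (hγ_pos : 0 < γ) (hγ_lt : γ < 1) {S : Config → ℂ}
    (hS : IsActionNear D S g) (hstat : IsStationary S g) {Δ : Affine.Simplex ℝ E4 4}
    (hg : CorrespondsTo D g Δ) {v : Tangent} (hv : (Complex.I * hessian S g v v).re = 0) :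
    v = 0 := by
  obtain ⟨r, hr, he⟩ := exists_norm_integrand_eq_exp hS hstat (norm_integrand_eq_one hg) v
  simp only [hv, mul_zero, zero_add] at he
  -- A factor between `|integrand| = exp (r t)` and `1` in modulus differs from `1` by `o(t²)`.
  have hface : ∀ f : ℝ → ℂ, (∀ t, ‖f t‖ ≤ 1) →
      (∀ t, ‖integrand D (chart g (t • v))‖ ≤ ‖f t‖) →
      (fun t : ℝ => 1 - ‖f t‖ ^ 2) =o[𝓝 0] fun t => t ^ 2 := by
    intro f hf1 hf
    refine Asymptotics.IsBigO.trans_isLittleO (Asymptotics.IsBigO.of_bound 2 ?_) hr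
    filter_upwards [he] with t ht
    have h2 := hf t
    rw [ht] at h2
    have h3 := (Real.add_one_le_exp (r t)).trans h2
    have h4 := hf1 t
    rw [Real.norm_of_nonneg (by nlinarith [norm_nonneg (f t)]), Real.norm_eq_abs]
    nlinarith [norm_nonneg (f t), neg_le_abs (r t)]
  obtain ⟨μ, hμ, hs⟩ := hg
  have hplus := eq_of_forall_isLittleO (G := fun a => (g.full a).1)
    (x := fun a => (tangentFull v a).1) isLinearMap_selfDual
    (fun _ _ => smul_eq_smul_of_selfDual_wedge_eq_zero) hμ (fun s => (hs s).1) fun a b hab => by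
      refine hface _ (fun t => norm_facePairing_le_one _ _ (D.ξ_unit _ _ hab.ne)
        (D.ξ_unit _ _ hab.ne')) fun t => ?_
      have := norm_integrand_le_norm_facePairing_fst (D := D) (g := chart g (t • v)) hγ_pos hab
      simpa only [full_chart, tangentFull_smul, Prod.smul_fst, Prod.smul_snd] using this
  have hminus := eq_of_forall_isLittleO (G := fun a => (g.full a).2)
    (x := fun a => (tangentFull v a).2) isLinearMap_antiSelfDual
    (fun _ _ => smul_eq_smul_of_antiSelfDual_wedge_eq_zero) hμ (fun s => (hs s).2)
    fun a b hab => by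
      refine hface _ (fun t => norm_facePairing_le_one _ _ (D.ξ_unit _ _ hab.ne)
        (D.ξ_unit _ _ hab.ne')) fun t => ?_
      have := norm_integrand_le_norm_facePairing_snd (D := D) (g := chart g (t • v)) hγ_lt hab
      simpa only [full_chart, tangentFull_smul, Prod.smul_fst, Prod.smul_snd] using this
  funext a
  have h1 := hplus a.castSucc (Fin.last 4)
  have h2 := hminus a.castSucc (Fin.last 4)
  simp only [tangentFull, Fin.snoc_castSucc, Fin.snoc_last] at h1 h2
  exact Prod.ext h1 h2

end EPRL

theorem mainTheorem1 (γ : ℝ) (hγ_pos : 0 < γ) (hγ_lt : γ < 1) (D : EPRL.BoundaryData γ)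
    (g : EPRL.Config) (S : EPRL.Config → ℂ) (hS : EPRL.IsActionNear D S g)
    (hstat : EPRL.IsStationary S g)
    (hgeom : ∃ Δ : Affine.Simplex ℝ EPRL.E4 4, EPRL.CorrespondsTo D g Δ) :
    EPRL.Nondegenerate (EPRL.hessian S g) := by
  obtain ⟨Δ, hΔ⟩ := hgeom
  intro x y hxy
  have hsymm : EPRL.hessian S g x y = EPRL.hessian S g y x :=
    (hS.contDiffAt.isSymmSndFDerivAt (by simp)).eq x y
  have h1 := EPRL.norm_integrand_eq_one hΔ
  have hx := EPRL.re_I_mul_hessian_nonpos hS hstat h1 x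
  have hy := EPRL.re_I_mul_hessian_nonpos hS hstat h1 y
  -- Pairing `x + i y` with its complex conjugate cancels the mixed terms.
  have hsum : Complex.I * EPRL.hessian S g x x + Complex.I * EPRL.hessian S g y y = 0 := by
    linear_combination Complex.I * hxy x + hxy y - Complex.I ^ 2 * hsymm -
      EPRL.hessian S g y x * Complex.I_sq
  have hre := congrArg Complex.re hsum
  rw [Complex.add_re, Complex.zero_re] at hre
  exact ⟨EPRL.eq_zero_of_re_I_mul_hessian_eq_zero hγ_pos hγ_lt hS hstat hΔ (by linarith),
    EPRL.eq_zero_of_re_I_mul_hessian_eq_zero hγ_pos hγ_lt hS hstat hΔ (by linarith)⟩
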